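/- Let $k\ge 2$ and $n>k$ be integers, and put $(\alpha,\beta,F)=(k,\,k-1,\,k^2-1)$. Then there is an integer $q_0$, depending only on $n$ and $k$, such that for every finite field $\mathbb{F}_q$ with $q\ge q_0$ there is a linear exact-repair regenerating code over $\mathbb{F}_q$ with parameters $(\alpha,\beta,F)$ for an $(n,k,d)$ distributed storage system with $d=k$. Its normalized per-node storage and repair bandwidth are $$(\bar\alpha,\bar\beta)=\left(\frac{\alpha}{F},\frac{\beta}{F}\right)=\left(\frac{k}{k^2-1},\frac{k-1}{k^2-1}\right).$$ Here a linear exact-repair regenerating code with parameters $(\alpha,\beta,F)$ for an $(n,k,d)$ system consists of $\alpha$ vectors of $\mathbb{F}_q^F$ for each node $i\in\{1,\dots,n\}$, spanning a subspace $\mathcal{W}_i$, such that * (data recovery) $\sum_{j\in\mathcal{A}}\mathcal{W}_j=\mathbb{F}_q^F$ for every set $\mathcal{A}$ of $k$ nodes; * (node repair) for every node $x$ and every set $\mathcal{A}$ of $d$ nodes with $x\notin\mathcal{A}$ there are subspaces $\mathcal{S}_j\subseteq\mathcal{W}_j$ with $\dim\mathcal{S}_j\le\beta$ $(j\in\mathcal{A})$,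 depending on $x$ and $\mathcal{A}$, with $\mathcal{W}_x\subseteq\sum_{j\in\mathcal{A}}\mathcal{S}_j$. Moreover, the code is an exact-repair regenerating code in the operational sense. Store in node $i$ the $\alpha$ linear combinations of the $F$ file symbols whose coefficient vectors are the vectors of node $i$. Then the file can be recovered from the contents of any set of at least $k$ nodes. The content of any node $x$ can be reproduced exactly from $\beta$ symbols sent by each node of any set of at least $d=k$ nodes not containing $x$, each helper computing its symbols from its own content. -/

import Mathlib

/-- An exact-repair regenerating code for an `(n, k, d)` distributed storage system over the
alphabet `Q`: a file of `F` symbols is encoded into `n` nodes storing `α` symbols each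
(`enc i` maps the file to the content of node `i`). Every set of at least `k` nodes determines
the file, and the content of every node `x` can be reproduced exactly from `β` symbols sent by
each node of any set `A` of at least `d` other nodes. What a helper sends is a function of its own
content, and may depend on `x` and `A`. -/
structure IsExactRepairCode (Q : Type*) (n k d α β F : ℕ)
    (enc : Fin n → (Fin F → Q) → (Fin α → Q)) : Prop where
  /-- Data recovery. -/
  data_recovery : ∀ A : Finset (Fin n), k ≤ A.card →
    ∃ decode : (A → Fin α → Q) → (Fin F → Q),
      ∀ file : Fin F → Q, decode (fun j => enc j file) = file
  /-- Exact repair of every node. -/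
  node_repair : ∀ (x : Fin n) (A : Finset (Fin n)), x ∉ A → d ≤ A.card →
    ∃ (send : A → (Fin α → Q) → (Fin β → Q)) (rebuild : (A → Fin β → Q) → (Fin α → Q)),
      ∀ file : Fin F → Q, rebuild (fun j => send j (enc j file)) = enc x file

/-- The subspace spanned by the `α` vectors stored in node `i`, inside the `F`-dimensional data
space `Fin F → K` whose standard basis represents the data symbols. -/
def nodeSpace {K : Type*} [Field K] {n α F : ℕ} (v : Fin n → Fin α → (Fin F → K))
    (i : Fin n) : Submodule K (Fin F → K) :=
  Submodule.span K (Set.range (v i))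

/-- The family `v`, where node `i` stores the `α` vectors `v i`, is a linear exact-repair
regenerating code with parameters `(α, β, F)` for an `(n, k, d)` distributed storage system. -/
structure IsLinearExactRepairCode (K : Type*) [Field K] (n k d α β F : ℕ)
    (v : Fin n → Fin α → (Fin F → K)) : Prop where
  /-- Data recovery: any `k` node spaces span the data space. -/
  data_recovery : ∀ A : Finset (Fin n), A.card = k → ⨆ j ∈ A, nodeSpace v j = ⊤
  /-- Node repair: for every node `x` and every set `A` of `d` other nodes, there are repair
  subspaces of the helper nodes, of dimension at most `β`, whose sum contains the node space
  of `x`. -/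
  node_repair : ∀ (x : Fin n) (A : Finset (Fin n)), x ∉ A → A.card = d →
    ∃ S : Fin n → Submodule K (Fin F → K),
      (∀ j ∈ A, S j ≤ nodeSpace v j ∧ Module.finrank K (S j) ≤ β) ∧
      nodeSpace v x ≤ ⨆ j ∈ A, S j

/-- The encoder given by the stored vectors: the `a`-th symbol in node `i` is the linear
combination of the data symbols whose coefficients are the coordinates of `v i a`. -/
def linearEncoder {K : Type*} [Field K] {n α F : ℕ} (v : Fin n → Fin α → (Fin F → K)) :
    Fin n → (Fin F → K) → (Fin α → K) :=
  fun i file a => ∑ t, v i a t * file t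

open Matrix

section Operational

variable {K : Type*} [Field K] {n k d α β F : ℕ} {v : Fin n → Fin α → (Fin F → K)}

/-! The data space is `k × k` matrices modulo scalar matrices, of dimension `k ^ 2 - 1`. Node `i`
stores the classes of all `u ψ_iᵀ`, where any `k` of the vectors `ψ_i` span `K ^ k`; Vandermonde
rows serve. Any `k` nodes then yield every matrix. To repair `x`, helper `j` sends only the `u ψ_jᵀ`
with `u ⊥ ψ_x`, a space of dimension `k - 1`. Over `k` helpers these span all matrices with columns
in `ψ_xᗮ`. Modulo scalars, `u ψ_xᵀ` is such a matrix: subtracting `(ψ_x ⬝ u) • 1` makes `ψ_xᵀ`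
annihilate it. Quotienting by the identity is what makes repair possible; `map_mem_of_columns_mem`
carries both arguments. The operational claim follows because data determined by received symbols is
a function of them. -/

theorem dotProduct_eq_of_mem_nodeSpace {i : Fin n} {x y w : Fin F → K}
    (h : linearEncoder v i x = linearEncoder v i y) (hw : w ∈ nodeSpace v i) :
    w ⬝ᵥ x = w ⬝ᵥ y := by
  induction hw using Submodule.span_induction with
  | mem w hw =>
    obtain ⟨a, rfl⟩ := hw
    exact congrFun h a
  | zero => simp
  | add w₁ w₂ _ _ h₁ h₂ => rw [add_dotProduct, add_dotProduct, h₁, h₂]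
  | smul c w _ h => rw [smul_dotProduct, smul_dotProduct, h]

theorem dotProduct_eq_of_mem_iSup {ι : Type*} {A : Finset ι} {S : ι → Submodule K (Fin F → K)}
    {x y w : Fin F → K} (h : ∀ j ∈ A, ∀ s ∈ S j, s ⬝ᵥ x = s ⬝ᵥ y) (hw : w ∈ ⨆ j ∈ A, S j) :
    w ⬝ᵥ x = w ⬝ᵥ y := by
  let E : Submodule K (Fin F → K) :=
    { carrier := {s | s ⬝ᵥ x = s ⬝ᵥ y}
      add_mem' := fun {s t} hs ht => by
        simp only [Set.mem_ofPred_eq] at *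
        rw [add_dotProduct, add_dotProduct, hs, ht]
      zero_mem' := by simp
      smul_mem' := fun c s hs => by
        simp only [Set.mem_ofPred_eq] at *
        rw [smul_dotProduct, smul_dotProduct, hs] }
  have hE : ⨆ j ∈ A, S j ≤ E := iSup₂_le h
  exact hE hw

theorem Submodule.exists_span_range_eq_of_finrank_le {V : Type*} [AddCommGroup V] [Module K V]
    [FiniteDimensional K V] (S : Submodule K V) (hS : Module.finrank K S ≤ β) :
    ∃ s : Fin β → V, Submodule.span K (Set.range s) = S := by
  let b := Module.finBasis K S
  -- A basis padded with zeros, so that exactly `β` vectors are listed.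
  refine ⟨fun i => if h : i.1 < Module.finrank K S then (b ⟨i, h⟩ : V) else 0, le_antisymm ?_ ?_⟩
  · rw [Submodule.span_le]
    rintro _ ⟨i, rfl⟩
    dsimp only
    split_ifs
    · exact (b _).2
    · exact S.zero_mem
  · have hb : S = Submodule.span K (Set.range fun i => (b i : V)) := by
      have := congrArg (Submodule.map S.subtype) b.span_eq
      rw [Submodule.map_span, ← Set.range_comp, Submodule.map_top, Submodule.range_subtype] at this
      exact this.symm
    conv_lhs => rw [hb]
    refine Submodule.span_mono ?_
    rintro _ ⟨i, rfl⟩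
    exact ⟨⟨i, i.2.trans_le hS⟩, by simp⟩

/-- A linear exact-repair code is an exact-repair code in the operational sense. -/
theorem IsLinearExactRepairCode.isExactRepairCode (h : IsLinearExactRepairCode K n k d α β F v) :
    IsExactRepairCode K n k d α β F (linearEncoder v) where
  data_recovery A hA := by
    obtain ⟨B, hBA, hB⟩ := Finset.exists_subset_card_eq hA
    have hinj : Function.Injective
        (fun (file : Fin F → K) (j : A) => linearEncoder v j file) := by
      intro x y hxy
      funext t
      have hmem : (Pi.single t 1 : Fin F → K) ∈ ⨆ j ∈ B, nodeSpace v j := by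
        rw [h.data_recovery B hB]
        trivial
      simpa using dotProduct_eq_of_mem_iSup (x := x) (y := y) (fun j hj s hs =>
        dotProduct_eq_of_mem_nodeSpace (congrFun hxy ⟨j, hBA hj⟩) hs) hmem
    obtain ⟨decode, hdecode⟩ := hinj.hasLeftInverse
    exact ⟨decode, hdecode⟩
  node_repair x A hx hA := by
    obtain ⟨B, hBA, hB⟩ := Finset.exists_subset_card_eq hA
    obtain ⟨S, hS, hxS⟩ := h.node_repair x B (fun hxB => hx (hBA hxB)) hB
    have hspan : ∀ j : A, ∃ s : Fin β → (Fin F → K), (∀ b, s b ∈ nodeSpace v j) ∧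
        (j.1 ∈ B → Submodule.span K (Set.range s) = S j) := by
      intro j
      by_cases hj : j.1 ∈ B
      · obtain ⟨s, hs⟩ := (S j).exists_span_range_eq_of_finrank_le (hS j hj).2
        exact ⟨s, fun b => (hS j hj).1 (hs ▸ Submodule.subset_span ⟨b, rfl⟩), fun _ => hs⟩
      -- Helpers beyond the chosen `d` send zeros.
      · exact ⟨0, fun _ => Submodule.zero_mem _, fun hj' => absurd hj' hj⟩
    choose s hsmem hsspan using hspan
    have hsend : ∀ j : A, ∃ g : (Fin α → K) → (Fin β → K),
        (fun file b => s j b ⬝ᵥ file) = g ∘ linearEncoder v j := fun j =>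
      (Function.factorsThrough_iff _).1 fun p q hpq =>
        funext fun b => dotProduct_eq_of_mem_nodeSpace hpq (hsmem j b)
    choose send hsend using hsend
    have hrebuild : ∃ g : (A → Fin β → K) → (Fin α → K),
        linearEncoder v x = g ∘ fun file j => send j (linearEncoder v j file) := by
      -- It suffices that two files producing the same transmissions agree on node `x`.
      refine (Function.factorsThrough_iff _).1 fun p q hpq => funext fun a => ?_
      refine dotProduct_eq_of_mem_iSup (fun j hj w hw => ?_)
        (hxS (Submodule.subset_span ⟨a, rfl⟩))
      rw [← hsspan ⟨j, hBA hj⟩ hj] at hw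
      induction hw using Submodule.span_induction with
      | mem w hw =>
        obtain ⟨b, rfl⟩ := hw
        have h₁ := congrFun (hsend ⟨j, hBA hj⟩)
        have h₂ := congrFun hpq ⟨j, hBA hj⟩
        exact congrFun ((h₁ p).trans (h₂.trans (h₁ q).symm)) b
      | zero => simp
      | add w₁ w₂ _ _ h₁ h₂ => rw [add_dotProduct, add_dotProduct, h₁, h₂]
      | smul c w _ h => rw [smul_dotProduct, smul_dotProduct, h]
    obtain ⟨rebuild, hrebuild⟩ := hrebuild
    exact ⟨send, rebuild, fun file => (congrFun hrebuild file).symm⟩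

end Operational

section Construction

variable {K : Type*} [Field K] {n k : ℕ}

theorem span_vandermonde_rows_eq_top {t : Fin n → K} (ht : Function.Injective t)
    {A : Finset (Fin n)} (hA : A.card = k) :
    Submodule.span K ((fun j (c : Fin k) => t j ^ (c : ℕ)) '' (A : Set (Fin n))) = ⊤ := by
  let e := A.orderEmbOfFin hA
  have hli : LinearIndependent K (vandermonde (t ∘ e)).row :=
    Matrix.linearIndependent_rows_of_det_ne_zero
      (Matrix.det_vandermonde_ne_zero_iff.2 (ht.comp e.injective))
  rw [eq_top_iff, ← hli.span_eq_top_of_card_eq_finrank' (by simp)]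
  refine Submodule.span_mono ?_
  rintro _ ⟨i, rfl⟩
  exact ⟨e i, A.orderEmbOfFin_mem hA i, rfl⟩

/-- If `T` contains the images of all `u wᵀ` for `u ∈ U` and `w` in a spanning set, it contains
the images of all matrices whose columns lie in `U`. -/
theorem map_mem_of_columns_mem {V : Type*} [AddCommGroup V] [Module K V]
    (π : Matrix (Fin k) (Fin k) K →ₗ[K] V) (T : Submodule K V) (U : Submodule K (Fin k → K))
    {s : Set (Fin k → K)} (hs : Submodule.span K s = ⊤)
    (h : ∀ w ∈ s, ∀ u ∈ U, π (vecMulVec u w) ∈ T) (M : Matrix (Fin k) (Fin k) K)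
    (hM : ∀ c, M.col c ∈ U) : π M ∈ T := by
  have hall : ∀ w, ∀ u ∈ U, π (vecMulVec u w) ∈ T := by
    intro w
    have hw : w ∈ Submodule.span K s := hs ▸ trivial
    induction hw using Submodule.span_induction with
    | mem w hw => exact h w hw
    | zero => intro u _; simp
    | add w₁ w₂ _ _ h₁ h₂ =>
      intro u hu
      rw [vecMulVec_add, map_add]
      exact T.add_mem (h₁ u hu) (h₂ u hu)
    | smul c w _ h =>
      intro u hu
      rw [vecMulVec_smul, map_smul]
      exact T.smul_mem c (h u hu)
  have hsum : M = ∑ c, vecMulVec (M.col c) (Pi.single c 1) := by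
    ext a b
    simp [Matrix.sum_apply, vecMulVec_apply, Pi.single_apply]
  rw [hsum, map_sum]
  exact T.sum_mem fun c _ => hall _ _ (hM c)

theorem finrank_ker_dotProduct {w : Fin k → K} (hw : w ≠ 0) :
    Module.finrank K (LinearMap.ker (dotProductBilin K K w)) + 1 = k := by
  have hne : dotProductBilin K K w ≠ 0 := by
    intro h0
    refine hw (funext fun i => ?_)
    simpa using LinearMap.congr_fun h0 (Pi.single i 1)
  have := Module.Dual.finrank_ker_add_one_of_ne_zero (K := K) (f := dotProductBilin K K w) hne
  simpa using this

theorem exists_linearMap_matrix_surjective_one_eq_zero (hk : 0 < k) :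
    ∃ π : Matrix (Fin k) (Fin k) K →ₗ[K] (Fin (k ^ 2 - 1) → K),
      Function.Surjective π ∧ π 1 = 0 := by
  have : Nonempty (Fin k) := ⟨⟨0, hk⟩⟩
  let L : Submodule K (Matrix (Fin k) (Fin k) K) := Submodule.span K {1}
  have hL : Module.finrank K L = 1 := finrank_span_singleton one_ne_zero
  have hq := L.finrank_quotient_add_finrank
  rw [hL, Module.finrank_matrix] at hq
  have hdim : Module.finrank K (Matrix (Fin k) (Fin k) K ⧸ L) =
      Module.finrank K (Fin (k ^ 2 - 1) → K) := by
    simp only [Fintype.card_fin, Module.finrank_self, mul_one, Module.finrank_fin_fun] at hq ⊢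
    rw [pow_two]
    omega
  let e := LinearEquiv.ofFinrankEq _ _ hdim
  refine ⟨e.toLinearMap ∘ₗ L.mkQ, e.surjective.comp L.mkQ_surjective, ?_⟩
  have h1 : L.mkQ 1 = 0 := by
    rw [Submodule.mkQ_apply, Submodule.Quotient.mk_eq_zero]
    exact Submodule.mem_span_singleton_self 1
  simp [h1]

theorem nodeSpace_vecMulVec_single {F : ℕ} (π : Matrix (Fin k) (Fin k) K →ₗ[K] (Fin F → K))
    (ψ : Fin n → Fin k → K) (i : Fin n) :
    nodeSpace (fun i a => π (vecMulVec (Pi.single a 1) (ψ i))) i =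
      LinearMap.range (π ∘ₗ (vecMulVecBilin K K).flip (ψ i)) := by
  apply le_antisymm
  · refine Submodule.span_le.2 ?_
    rintro _ ⟨a, rfl⟩
    exact ⟨Pi.single a 1, rfl⟩
  · rintro _ ⟨u, rfl⟩
    rw [pi_eq_sum_univ' u, map_sum]
    refine Submodule.sum_mem _ fun a _ => ?_
    rw [map_smul]
    refine Submodule.smul_mem _ _ (Submodule.subset_span ⟨a, ?_⟩)
    simp only [LinearMap.comp_apply, LinearMap.flip_apply, vecMulVecBilin_apply_apply]

/-- Storing the classes of `e_a ψ_iᵀ` in the space of matrices modulo scalars gives a linear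
exact-repair code, provided any `k` of the vectors `ψ_i` span. -/
theorem isLinearExactRepairCode_of_span_eq_top {F : ℕ}
    (π : Matrix (Fin k) (Fin k) K →ₗ[K] (Fin F → K)) (hπ : Function.Surjective π) (hπ1 : π 1 = 0)
    (ψ : Fin n → Fin k → K) (hψ0 : ∀ i, ψ i ≠ 0)
    (hψ : ∀ A : Finset (Fin n), A.card = k → Submodule.span K (ψ '' (A : Set (Fin n))) = ⊤) :
    IsLinearExactRepairCode K n k k k (k - 1) F
      (fun i a => π (vecMulVec (Pi.single a 1) (ψ i))) where
  data_recovery A hA := by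
    rw [eq_top_iff]
    intro y _
    obtain ⟨M, rfl⟩ := hπ y
    refine map_mem_of_columns_mem π _ ⊤ (hψ A hA) ?_ M fun _ => trivial
    rintro _ ⟨j, hj, rfl⟩ u -
    refine Submodule.mem_iSup_of_mem j (Submodule.mem_iSup_of_mem hj ?_)
    rw [nodeSpace_vecMulVec_single]
    exact ⟨u, rfl⟩
  node_repair x A _ hA := by
    let U : Submodule K (Fin k → K) := LinearMap.ker (dotProductBilin K K (ψ x))
    refine ⟨fun j => U.map (π ∘ₗ (vecMulVecBilin K K).flip (ψ j)), fun j _ => ⟨?_, ?_⟩, ?_⟩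
    · rw [nodeSpace_vecMulVec_single]
      exact LinearMap.map_le_range
    · refine (Submodule.finrank_map_le _ _).trans ?_
      have := finrank_ker_dotProduct (hψ0 x)
      change Module.finrank K (LinearMap.ker (dotProductBilin K K (ψ x))) ≤ _
      omega
    · rw [nodeSpace_vecMulVec_single]
      rintro _ ⟨u, rfl⟩
      -- The representative modulo scalars whose columns are orthogonal to `ψ x`.
      have hshift : (π ∘ₗ (vecMulVecBilin K K).flip (ψ x)) u =
          π (vecMulVec u (ψ x) - (ψ x ⬝ᵥ u) • 1) := by
        rw [map_sub, map_smul, hπ1, smul_zero, sub_zero]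
        rfl
      rw [hshift]
      refine map_mem_of_columns_mem π _ U (hψ A hA) ?_ _ fun c => ?_
      · rintro _ ⟨j, hj, rfl⟩ w hw
        exact Submodule.mem_iSup_of_mem j (Submodule.mem_iSup_of_mem hj ⟨w, hw, rfl⟩)
      · have hcol : (vecMulVec u (ψ x) - (ψ x ⬝ᵥ u) • (1 : Matrix (Fin k) (Fin k) K)).col c =
            ψ x c • u - (ψ x ⬝ᵥ u) • Pi.single c 1 := by
          funext a
          simp [vecMulVec_apply, Matrix.one_apply, Pi.single_apply, mul_comm]
        -- Pairing column `c` with `ψ x` gives `ψ x c * (ψ x ⬝ᵥ u)` twice, with opposite signs.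
        rw [LinearMap.mem_ker, hcol, map_sub, map_smul, map_smul]
        simp [mul_comm]

end Construction

theorem theorem1 (n k : ℕ) (hk : 2 ≤ k) (hn : k < n) :
    ∃ α β F : ℕ, (α = k ∧ β + 1 = k ∧ F + 1 = k ^ 2) ∧
      ((α : ℚ) / F = (k : ℚ) / ((k : ℚ) ^ 2 - 1) ∧
        (β : ℚ) / F = ((k : ℚ) - 1) / ((k : ℚ) ^ 2 - 1)) ∧
      ∃ q₀ : ℕ, ∀ (K : Type*) [Field K] [Finite K], q₀ ≤ Nat.card K →
        ∃ v : Fin n → Fin α → (Fin F → K),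
          IsLinearExactRepairCode K n k k α β F v ∧
          IsExactRepairCode K n k k α β F (linearEncoder v) := by
  have hk2 : 1 ≤ k ^ 2 := Nat.one_le_pow _ _ (by omega)
  -- `q₀ = n` leaves room for `n` distinct Vandermonde nodes.
  refine ⟨k, k - 1, k ^ 2 - 1, ⟨rfl, by omega, by omega⟩, ⟨?_, ?_⟩, n, ?_⟩
  · push_cast [Nat.cast_sub hk2]
    rfl
  · push_cast [Nat.cast_sub hk2, Nat.cast_sub (show 1 ≤ k by omega)]
    rfl
  · intro K _ _ hK
    have : Fintype K := Fintype.ofFinite K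
    obtain ⟨t⟩ : Nonempty (Fin n ↪ K) :=
      Function.Embedding.nonempty_of_card_le (by simpa [Nat.card_eq_fintype_card] using hK)
    obtain ⟨π, hπ, hπ1⟩ :=
      exists_linearMap_matrix_surjective_one_eq_zero (K := K) (show 0 < k by omega)
    have hcode := isLinearExactRepairCode_of_span_eq_top π hπ hπ1
      (fun j (c : Fin k) => t j ^ (c : ℕ))
      -- The zeroth coordinate is `t i ^ 0 = 1`, even when `t i = 0`.
      (fun i h0 => by simpa using congrFun h0 ⟨0, by omega⟩)
      (fun A hA => span_vandermonde_rows_eq_top t.injective hA)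
    exact ⟨_, hcode, hcode.isExactRepairCode⟩
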